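/- Let $\mathbb{K}$ be a field and let $m$ be a positive integer. **Definitions.** For a finite totally ordered index set $I$, a shift $s\in\mathbb{Z}^I$ and a row vector $p\in\mathbb{K}[X]^{I}$, the $s$-degree of $p$ is $\max_j(\deg p_j+s_j)$ (with $\deg 0=-\infty$). If $p\ne 0$, its $s$-pivot index is the largest $j$ attaining this maximum, and $p_j$ and $\deg p_j$ are then its $s$-pivot entry and $s$-pivot degree. For a matrix $P$, $\mathrm{rdeg}_s(P)$ is the tuple of $s$-degrees of its rows. A matrix of full row rank is in $s$-Popov form if the $s$-pivot indices of its rows are strictly increasing, its pivot entries are monic, and in each column containing a pivot the nonpivot entries have degree less than the pivot entry; its $s$-pivot degree is then the tuple of the $s$-pivot degrees of its rows. For a nonzero modulus $\mathfrak{a}\in\mathbb{K}[X]$ and a column $H\in\mathbb{K}[X]^{I\times 1}$, the $s$-Popov solution basis for $(\mathfrak{a},H)$ is the unique square matrix in $s$-Popov form whose rows form a basis of the $\mathbb{K}[X]$-module $\{p\in\mathbb{K}[X]^{1\times I} : pH=0 \bmod \mathfrak{a}\}$; its $s$-pivot degree is called the $s$-minimal degree of $(\mathfrak{a},H)$. The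 $s$-Popov order basis for $H$ and $\tau\in\mathbb{N}$ is the $s$-Popov solution basis for $(X^\tau,H)$. For a tuple of nonnegative integers or of integers, $|\cdot|$ denotes the sum of its entries. Given $\delta\in\mathbb{N}^I$ and $t\in\mathbb{Z}^I$ with $I=\{\mu_1,\dots,\mu_n\}$, $t_{\mu_1}\le\dots\le t_{\mu_n}$, an integer $i\in\{1,\dots,n-1\}$ is a splitting index for $(\delta,t)$ if $\delta_{\mu_k}+t_{\mu_k}-t_{\mu_{i+1}}<0$ for all $1\le k\le i$. **Setting.** Let $\mathfrak{m}\in\mathbb{K}[X]$ be nonzero of degree $\sigma$, let $F\in\mathbb{K}[X]^{m\times1}$ have all its entries of degree $<\deg\mathfrak{m}$, let $s\in\mathbb{Z}^m$, and let $\delta\in\mathbb{N}^m$ be the $s$-minimal degree of $(\mathfrak{m},F)$. Fix a permutation $\pi$ of $\{1,\dots,m\}$ with $s_{\pi_1}\le\dots\le s_{\pi_m}$. The subscript $[:k]$ (resp. $[k+1:]$) denotes restriction of a tuple, or of the rows or columns of a matrix, to the indices in $\{\pi_1,\dots,\pi_k\}$ (resp. $\{\pi_{k+1},\dots,\pi_m\}$),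 sorted increasingly; for a matrix, the first subscript refers to rows, the second one to columns, and $*$ to all columns. Let $2\le j\le m$, let $\delta^{(0)}$ be the $s_{[:j]}$-minimal degree of $(\mathfrak{m},F_{[:j]})$, and let $i$ be a splitting index for $(\delta^{(0)},s_{[:j]})$. Let $\delta^{(1)}$ be the $s_{[:i]}$-minimal degree of $(\mathfrak{m},F_{[:i]})$. Put $s^{(2)}=s_{[i+1:]}$ and $d=-\delta^{(1)}+\min(s^{(2)})-2\sigma\in\mathbb{Z}^i$ (constants being added to every entry), let $v\in\mathbb{Z}^m$ be such that $v_{[:i]}=d$ and $v_{[i+1:]}=s^{(2)}$, and let $u=(v,\min(d))\in\mathbb{Z}^{m+1}$. Let $$\begin{bmatrix}A & \mathbf{q}\\ \mathbf{p} & q\end{bmatrix},\qquad A\in\mathbb{K}[X]^{m\times m},\ \mathbf{q}\in\mathbb{K}[X]^{m\times1},\ \mathbf{p}\in\mathbb{K}[X]^{1\times m},\ q\in\mathbb{K}[X],$$ be the $u$-Popov order basis for the column $\begin{bmatrix}F\\ \mathfrak{m}\end{bmatrix}$ and the order $2\sigma$. Let $P^{(2)}=A_{[i+1:],[i+1:]}$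 (which is in $s^{(2)}$-Popov form) and let $\delta^{(2)}$ be its $s^{(2)}$-pivot degree. **Statement.** Define $$\mathfrak{n}=X^{-2\sigma}\,(\mathbf{p}F+q\,\mathfrak{m}),\qquad G=X^{-2\sigma}\,(A_{[i+1:],*}F+\mathbf{q}_{[i+1:]}\,\mathfrak{m}).$$ Then $\mathfrak{n}\in\mathbb{K}[X]$, $G\in\mathbb{K}[X]^{(m-i)\times1}$, and $$\deg G<\deg\mathfrak{n}\le\sigma-|\delta^{(1)}|-|\delta^{(2)}| .$$ Moreover, let $P^{(3)}$ be the $t$-Popov solution basis for $(\mathfrak{n},G)$, where $t=\mathrm{rdeg}_{s^{(2)}}(P^{(2)})$, and let $\delta^{(3)}$ be its $t$-pivot degree. Then $$(\delta_{[:i]},\delta_{[i+1:]})=(\delta^{(1)},\ \delta^{(2)}+\delta^{(3)}).$$ -/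

import Mathlib

open Polynomial

noncomputable section

/-- Degree of a polynomial as an element of `{-∞} ∪ ℤ` (the zero polynomial has degree `-∞ = ⊥`). -/
def zdeg {K : Type*} [Field K] (p : K[X]) : WithBot ℤ :=
  p.degree.map (fun n : ℕ => (n : ℤ))

/-- The `s`-degree `max_j (deg p_j + s_j)` of a row vector `p`, in `{-∞} ∪ ℤ`. -/
def shiftedDegree {K : Type*} [Field K] {ι : Type*} [Fintype ι] (s : ι → ℤ) (p : ι → K[X]) :
    WithBot ℤ :=
  Finset.univ.sup fun j => zdeg (p j) + (s j : WithBot ℤ)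

/-- The `s`-row degree of a matrix without zero row, as a tuple of integers
(the entry at a zero row, whose `s`-degree is `-∞`, is set to `0` and is never used). -/
def rowDegree {K : Type*} [Field K] {ρ ι : Type*} [Fintype ι] (s : ι → ℤ)
    (P : Matrix ρ ι K[X]) : ρ → ℤ :=
  fun i => (shiftedDegree s (P i)).unbotD 0

/-- `j` is the `s`-pivot index of the row vector `p`: `p` is nonzero and `j` is the largest index
at which the `s`-degree of `p` is attained. -/
def IsPivotIndex {K : Type*} [Field K] {ι : Type*} [Fintype ι] [LinearOrder ι]
    (s : ι → ℤ) (p : ι → K[X]) (j : ι) : Prop :=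
  p ≠ 0 ∧ IsGreatest {k : ι | shiftedDegree s p = zdeg (p k) + (s k : WithBot ℤ)} j

/-- A polynomial matrix (of full row rank) is in `s`-Popov form: the `s`-pivot indices of its rows
are strictly increasing, the pivot entries are monic, and in each column which contains a pivot
the nonpivot entries have degree less than the pivot entry. -/
def IsPopov {K : Type*} [Field K] {ρ ι : Type*} [LinearOrder ρ] [Fintype ι] [LinearOrder ι]
    (s : ι → ℤ) (P : Matrix ρ ι K[X]) : Prop :=
  LinearIndependent K[X] P.row ∧
  ∃ piv : ρ → ι, StrictMono piv ∧
    (∀ i, IsPivotIndex s (P i) (piv i)) ∧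
    (∀ i, (P i (piv i)).Monic) ∧
    (∀ i k, k ≠ i → (P k (piv i)).degree < (P i (piv i)).degree)

/-- `δ` is the `s`-pivot degree of `P`: `δ i` is the degree of the `s`-pivot entry of row `i`. -/
def HasPivotDegree {K : Type*} [Field K] {ρ ι : Type*} [Fintype ι] [LinearOrder ι]
    (s : ι → ℤ) (P : Matrix ρ ι K[X]) (δ : ρ → ℕ) : Prop :=
  ∀ i, ∃ j, IsPivotIndex s (P i) j ∧ (P i j).degree = (δ i : WithBot ℕ)

/-- The module of solutions for `(a, F)`, in the case of one equation: all row vectors `p` such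
that `p F = 0 mod a`, where `F` is a column of polynomials. -/
def solutionModule {K : Type*} [Field K] {ι : Type*} [Fintype ι] (a : K[X]) (F : ι → K[X]) :
    Submodule K[X] (ι → K[X]) where
  carrier := {p | a ∣ p ⬝ᵥ F}
  zero_mem' := by simp
  add_mem' := by
    intro p q hp hq
    simp only [Set.mem_ofPred_eq, add_dotProduct] at *
    exact dvd_add hp hq
  smul_mem' := by
    intro c p hp
    simp only [Set.mem_ofPred_eq, smul_dotProduct, smul_eq_mul] at *
    exact Dvd.dvd.mul_left hp c

/-- `P` is a solution basis for `(a, F)`: its rows form a basis of the solution module. -/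
def IsSolutionBasis {K : Type*} [Field K] {ι : Type*} [Fintype ι] (a : K[X]) (F : ι → K[X])
    (P : Matrix ι ι K[X]) : Prop :=
  LinearIndependent K[X] P.row ∧ Submodule.span K[X] (Set.range P.row) = solutionModule a F

/-- `P` is the `s`-Popov solution basis for `(a, F)`. -/
def IsPopovSolutionBasis {K : Type*} [Field K] {ι : Type*} [Fintype ι] [LinearOrder ι]
    (s : ι → ℤ) (a : K[X]) (F : ι → K[X]) (P : Matrix ι ι K[X]) : Prop :=
  IsSolutionBasis a F P ∧ IsPopov s P

/-- `P` is the `s`-Popov order basis for the column `N` and the order `τ`: the `s`-Popov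
solution basis for `(X ^ τ, N)`. -/
def IsPopovOrderBasis {K : Type*} [Field K] {ι : Type*} [Fintype ι] [LinearOrder ι]
    (s : ι → ℤ) (N : ι → K[X]) (τ : ℕ) (P : Matrix ι ι K[X]) : Prop :=
  IsPopovSolutionBasis s (X ^ τ) N P

/-- `δ` is the `s`-minimal degree of `(a, F)`: the `s`-pivot degree of the `s`-Popov solution
basis for `(a, F)`. -/
def IsMinimalDegree {K : Type*} [Field K] {ι : Type*} [Fintype ι] [LinearOrder ι]
    (s : ι → ℤ) (a : K[X]) (F : ι → K[X]) (δ : ι → ℕ) : Prop :=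
  ∃ P : Matrix ι ι K[X], IsPopovSolutionBasis s a F P ∧ HasPivotDegree s P δ

/-- The first `i` indices `{π_1, …, π_i}` in the ordering given by `π` (positions are counted from
`0` in `Fin m`), with the order inherited from `Fin m`, so that subtuples and submatrices are
indexed by this set sorted increasingly. -/
abbrev Head {m : ℕ} (π : Equiv.Perm (Fin m)) (i : ℕ) : Type :=
  {k : Fin m // ((π.symm k : Fin m) : ℕ) < i}

/-- The remaining indices `{π_{i+1}, …, π_m}`, with the order inherited from `Fin m`. -/
abbrev Tail {m : ℕ} (π : Equiv.Perm (Fin m)) (i : ℕ) : Type :=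
  {k : Fin m // ¬ ((π.symm k : Fin m) : ℕ) < i}

/-- `i` is a splitting index for `(d, t)`, two tuples of length `n` with entries indexed by `ι`:
for an enumeration `μ` of the indices along which `t` is non-decreasing one has
`1 ≤ i ≤ n - 1` and `d_{μ_j} + t_{μ_j} - t_{μ_{i+1}} < 0` for `1 ≤ j ≤ i`.
(Positions are counted from `0`, so that `μ_{i+1}` is `μ ⟨i, _⟩`. The inequalities force the entries
of `t` at `μ_1, …, μ_i` to be smaller than all others, so the choice of `μ` does not matter.) -/
def IsSplittingIndex {ι : Type*} (n : ℕ) (d : ι → ℕ) (t : ι → ℤ) (i : ℕ) : Prop :=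
  1 ≤ i ∧ ∃ h : i < n, ∃ μ : Fin n ≃ ι, Monotone (t ∘ μ) ∧
    ∀ j : Fin n, (j : ℕ) < i → (d (μ j) : ℤ) + t (μ j) - t (μ ⟨i, h⟩) < 0

/-- The tuple `v` of length `m` with subtuple `d` at `{π_1, …, π_i}` and subtuple `e` at
`{π_{i+1}, …, π_m}`. -/
def glue {m : ℕ} {α : Type*} (π : Equiv.Perm (Fin m)) (i : ℕ) (d : Head π i → α)
    (e : Tail π i → α) : Fin m → α :=
  fun k => if h : ((π.symm k : Fin m) : ℕ) < i then d ⟨k, h⟩ else e ⟨k, h⟩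

/-- The tuple `(v_1, …, v_m, c)`. -/
def appendEntry {m : ℕ} {α : Type*} (v : Fin m → α) (c : α) : Fin (m + 1) → α :=
  Fin.snoc (α := fun _ => α) v c

end

open Polynomial

noncomputable section

/-! The minimal degree at an index is the least degree of a solution with its pivot there. The
splitting index keeps the `s`-degrees of the head rows of the full basis below every tail shift.
These rows vanish on the tail, which gives `δ = δ₁` on the head.

Every solution `p` lifts to an exact relation `pF + y𝔪 = 0`, with `deg y` controlled because `deg F
< deg 𝔪`. Exact relations lie in the order module. For the shift `u`, the lifted head rows compete
with the head rows of the order basis `B`, which are thereby so small that their residuals,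
multiples of `X ^ (2 * σ)`, must vanish (`dotProduct_eq_zero_of_head`). Only the tail rows and the
last row can leave residuals, namely `G` and `𝔫`, so modulo head rows an exact relation is a
relation `wG + y𝔫 = 0`.

Pivot degrees add under products of bases (`HasPivotAt.vecMul`); `le_of_residual` and
`exists_residual` then give the two halves of `δ = δ₂ + δ₃` on the tail. The bound on `deg 𝔫` holds
because `deg 𝔫 + σ` is the last pivot degree of `B`, and all its pivot degrees sum to at most `2σ`
(`sum_le_of_order`). -/

/-- The degree of `f` is at most the integer `D`. -/
def DegLE {K : Type*} [Field K] (f : K[X]) (D : ℤ) : Prop :=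
  f ≠ 0 → (f.natDegree : ℤ) ≤ D

/-! ### Integer degree bounds -/

namespace DegLE

variable {K : Type*} [Field K] {f g : K[X]} {a b : ℤ}

theorem mono (h : DegLE f a) (hab : a ≤ b) : DegLE f b := fun hf => (h hf).trans hab

theorem zero (a : ℤ) : DegLE (0 : K[X]) a := fun h => absurd rfl h

theorem eq_zero (h : DegLE f a) (ha : a < 0) : f = 0 := by
  by_contra hf
  have := h hf
  omega

theorem add (hf : DegLE f a) (hg : DegLE g a) : DegLE (f + g) a := by
  intro h
  by_cases h1 : f = 0
  · subst h1
    rw [zero_add] at h ⊢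
    exact hg h
  by_cases h2 : g = 0
  · subst h2
    rw [add_zero] at h ⊢
    exact hf h
  have := natDegree_add_le f g
  have := hf h1
  have := hg h2
  omega

theorem sum {ι : Type*} {s : Finset ι} {f : ι → K[X]} (h : ∀ k ∈ s, DegLE (f k) a) :
    DegLE (∑ k ∈ s, f k) a := by
  classical
  induction s using Finset.induction_on with
  | empty => simpa using zero a
  | insert k s hk ih =>
    rw [Finset.sum_insert hk]
    exact add (h k (Finset.mem_insert_self k s))
      (ih fun l hl => h l (Finset.mem_insert_of_mem hl))

theorem mul (hf : DegLE f a) (hg : DegLE g b) : DegLE (f * g) (a + b) := by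
  intro h
  have h1 := left_ne_zero_of_mul h
  have h2 := right_ne_zero_of_mul h
  rw [natDegree_mul h1 h2]
  have := hf h1
  have := hg h2
  push_cast
  omega

theorem neg (hf : DegLE f a) : DegLE (-f) a := by
  intro h
  rw [natDegree_neg]
  exact hf (neg_ne_zero.mp h)

theorem natDegree_self (f : K[X]) : DegLE f f.natDegree := fun _ => le_rfl

theorem of_degree_lt {n : ℕ} (h : f.degree < g.degree) (hn : g.natDegree = n) :
    DegLE f ((n : ℤ) - 1) := by
  intro hf
  have := natDegree_lt_natDegree hf h
  omega

theorem degree_lt (h : DegLE f ((g.natDegree : ℤ) - 1)) (hg : g ≠ 0) : f.degree < g.degree := by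
  by_cases hf : f = 0
  · subst hf
    rw [degree_zero]
    exact bot_lt_iff_ne_bot.mpr (degree_ne_bot.mpr hg)
  · have := h hf
    exact degree_lt_degree (by omega)

theorem of_mul (h : DegLE (f * g) a) (hg : g ≠ 0) : DegLE f (a - g.natDegree) := by
  intro hf
  have := h (mul_ne_zero hf hg)
  rw [natDegree_mul hf hg] at this
  push_cast at this
  omega

theorem natDegree_add_right (hf : DegLE f ((g.natDegree : ℤ) - 1)) (hg : g ≠ 0) :
    f + g ≠ 0 ∧ (f + g).natDegree = g.natDegree := by
  have h := hf.degree_lt hg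
  refine ⟨fun h0 => ?_, natDegree_add_eq_right_of_degree_lt h⟩
  rw [eq_neg_of_add_eq_zero_left h0, degree_neg] at h
  exact lt_irrefl _ h

theorem dvd_eq_zero {n : ℕ} (h : DegLE f ((n : ℤ) - 1)) (hd : X ^ n ∣ f) : f = 0 := by
  by_contra hf
  have h1 := h hf
  have h2 := natDegree_le_of_dvd hd hf
  rw [natDegree_X_pow] at h2
  omega

end DegLE

/-! ### Pivots and the predictable pivot property -/

/-- `1` if `l < k` and `0` otherwise: the margin by which the entry `k` has to stay below a pivot
at `l`. -/
def tie {ι : Type*} [LinearOrder ι] (l k : ι) : ℤ := if l < k then 1 else 0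

section tie

variable {ι : Type*} [LinearOrder ι]

theorem tie_self (l : ι) : tie l l = 0 := by simp [tie]

theorem tie_nonneg (l k : ι) : 0 ≤ tie l k := by
  unfold tie
  split_ifs <;> simp

theorem tie_le_one (l k : ι) : tie l k ≤ 1 := by
  unfold tie
  split_ifs <;> simp

theorem tie_triangle (l a k : ι) : tie l k ≤ tie l a + tie a k := by
  unfold tie
  split_ifs with h1 h2 h3 h3 <;> try norm_num
  exact absurd (lt_of_lt_of_le h1 (not_lt.mp h3)) h2

theorem tie_add_tie {l k : ι} (h : l ≠ k) : tie l k + tie k l = 1 := by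
  unfold tie
  rcases lt_or_gt_of_ne h with h | h <;> simp [h, h.le]

theorem tie_coe {p : ι → Prop} (l k : Subtype p) : tie (l : ι) (k : ι) = tie l k := rfl

theorem tie_castSucc {m : ℕ} (l k : Fin m) : tie l.castSucc k.castSucc = tie l k := by
  simp [tie]

theorem tie_castSucc_last {m : ℕ} (l : Fin m) : tie l.castSucc (Fin.last m) = 1 := by
  simp [tie, Fin.castSucc_lt_last]

end tie

/-- The row `p` has its `s`-pivot at `l`, of degree `e`. -/
def HasPivotAt {K : Type*} [Field K] {ι : Type*} [LinearOrder ι] (s : ι → ℤ) (p : ι → K[X])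
    (l : ι) (e : ℕ) : Prop :=
  p l ≠ 0 ∧ (p l).natDegree = e ∧ ∀ k, DegLE (p k) (e + s l - s k - tie l k)

namespace HasPivotAt

variable {K : Type*} [Field K] {ι : Type*} [LinearOrder ι] {s : ι → ℤ} {p : ι → K[X]}
  {l l' : ι} {e e' : ℕ}

/-- Two distinct pivots would bound each other, with a total margin of 1. -/
theorem eq_and_eq (h : HasPivotAt s p l e) (h' : HasPivotAt s p l' e') : l = l' ∧ e = e' := by
  have hl : l = l' := by
    by_contra hne
    have h1 := h.2.2 l' h'.1
    have h2 := h'.2.2 l h.1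
    rw [h'.2.1] at h1
    rw [h.2.1] at h2
    have := tie_add_tie hne
    omega
  subst hl
  exact ⟨rfl, h.2.1.symm.trans h'.2.1⟩

theorem exists_of_ne_zero [Fintype ι] (s : ι → ℤ) (hp : p ≠ 0) :
    ∃ l e, HasPivotAt s p l e := by
  classical
  obtain ⟨k₀, hk₀⟩ := Function.ne_iff.mp hp
  obtain ⟨l, hl, hmax⟩ := Finset.exists_max_image (Finset.univ.filter fun k => p k ≠ 0)
    (fun k => toLex (((p k).natDegree : ℤ) + s k, k)) ⟨k₀, by simpa using hk₀⟩
  refine ⟨l, (p l).natDegree, (Finset.mem_filter.mp hl).2, rfl, fun k hk => ?_⟩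
  have := hmax k (by simpa using hk)
  rw [Prod.Lex.toLex_le_toLex] at this
  unfold tie
  split_ifs with hlk
  · rcases this with h | ⟨-, h⟩
    · simp only at h
      omega
    · exact absurd hlk (not_lt.mpr h)
  · rcases this with h | ⟨h, -⟩ <;> simp only at h <;> omega

/-- Serves to absorb a multiple of the last row of `B`, whose `s`-degree on the tail is too small to
move the pivot. -/
theorem add {y : ι → K[X]} (h : HasPivotAt s p l e)
    (hy : ∀ k, DegLE (y k) (e + s l - s k - 1)) : HasPivotAt s (p + y) l e := by
  have h1 : DegLE (y l) (((p l).natDegree : ℤ) - 1) := (hy l).mono (by rw [h.2.1]; omega)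
  have h2 := h1.natDegree_add_right h.1
  refine ⟨by simpa [add_comm] using h2.1, ?_, fun k => ?_⟩
  · rw [Pi.add_apply, add_comm, h2.2, h.2.1]
  · exact (h.2.2 k).add ((hy k).mono (by have := tie_le_one l k; omega))

/-- The predictable pivot property. -/
theorem vecMul [Fintype ι] {P : Matrix ι ι K[X]} {β : ι → ℕ}
    (hP : ∀ k, HasPivotAt s (P k) k (β k))
    (h : HasPivotAt (fun k => (β k : ℤ) + s k) p l e) :
    HasPivotAt s (Matrix.vecMul p P) l (e + β l) := by
  classical
  have hterm (a k : ι) : DegLE (p a * P a k) (e + β l + s l - s k - (tie l a + tie a k)) :=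
    ((h.2.2 a).mul ((hP a).2.2 k)).mono (by dsimp only; omega)
  have hl : Matrix.vecMul p P l = ∑ a ∈ Finset.univ.erase l, p a * P a l + p l * P l l :=
    (Finset.sum_erase_add _ _ (Finset.mem_univ l)).symm
  have hne : p l * P l l ≠ 0 := mul_ne_zero h.1 (hP l).1
  have hdeg : (p l * P l l).natDegree = e + β l := by
    rw [natDegree_mul h.1 (hP l).1, h.2.1, (hP l).2.1]
  -- For `a ≠ l` one of the margins `tie l a`, `tie a l` is 1, so `p l * P l l` strictly dominates
  -- column `l` and cannot cancel.
  have hsum : DegLE (∑ a ∈ Finset.univ.erase l, p a * P a l)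
      (((p l * P l l).natDegree : ℤ) - 1) := by
    refine DegLE.sum fun a ha => (hterm a l).mono ?_
    have := tie_add_tie (Finset.ne_of_mem_erase ha).symm
    rw [hdeg]
    push_cast
    omega
  have h2 := hsum.natDegree_add_right hne
  refine ⟨by rw [hl]; exact h2.1, by rw [hl, h2.2, hdeg], fun k => ?_⟩
  refine DegLE.sum fun a _ => (hterm a k).mono ?_
  have := tie_triangle l a k
  push_cast
  omega

end HasPivotAt

/-! ### From pivot indices to integer bounds -/

section bridge

theorem zdeg_add_le_shiftedDegree {K : Type*} [Field K] {ι : Type*} [Fintype ι] (s : ι → ℤ)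
    (p : ι → K[X]) (k : ι) : zdeg (p k) + (s k : WithBot ℤ) ≤ shiftedDegree s p :=
  Finset.le_sup (f := fun j => zdeg (p j) + (s j : WithBot ℤ)) (Finset.mem_univ k)

variable {K : Type*} [Field K] {ι : Type*} [Fintype ι] [LinearOrder ι] {s : ι → ℤ} {p : ι → K[X]}
  {j : ι}

theorem zdeg_eq_natDegree {f : K[X]} (hf : f ≠ 0) : zdeg f = ((f.natDegree : ℤ) : WithBot ℤ) := by
  rw [zdeg, degree_eq_natDegree hf]
  rfl

theorem zdeg_zero : zdeg (0 : K[X]) = ⊥ := by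
  rw [zdeg, degree_zero]
  rfl

theorem IsPivotIndex.shiftedDegree_eq (h : IsPivotIndex s p j) :
    shiftedDegree s p = zdeg (p j) + (s j : WithBot ℤ) := h.2.1

theorem IsPivotIndex.apply_ne_zero (h : IsPivotIndex s p j) : p j ≠ 0 := by
  intro h0
  obtain ⟨k, hk⟩ := Function.ne_iff.mp h.1
  have := zdeg_add_le_shiftedDegree s p k
  rw [h.shiftedDegree_eq, h0, zdeg_zero, WithBot.bot_add, zdeg_eq_natDegree hk,
    ← WithBot.coe_add] at this
  exact WithBot.coe_ne_bot (le_bot_iff.mp this)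

theorem IsPivotIndex.hasPivotAt (h : IsPivotIndex s p j) :
    HasPivotAt s p j (p j).natDegree := by
  have h0 := h.apply_ne_zero
  refine ⟨h0, rfl, fun k hk => ?_⟩
  have hle := zdeg_add_le_shiftedDegree s p k
  have heq := h.shiftedDegree_eq
  rw [heq, zdeg_eq_natDegree hk, zdeg_eq_natDegree h0, ← WithBot.coe_add, ← WithBot.coe_add,
    WithBot.coe_le_coe] at hle
  unfold tie
  split_ifs with hjk
  · have hne : ((p k).natDegree : ℤ) + s k ≠ (p j).natDegree + s j := by
      intro he
      have : k ≤ j := h.2.2 (by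
        change shiftedDegree s p = _
        rw [heq, zdeg_eq_natDegree hk, zdeg_eq_natDegree h0, ← WithBot.coe_add,
          ← WithBot.coe_add, he])
      exact absurd hjk (not_lt.mpr this)
    omega
  · omega

theorem HasPivotDegree.eq_of_hasPivotAt {ρ : Type*} {P : Matrix ρ ι K[X]} {δ : ρ → ℕ}
    (h : HasPivotDegree s P δ) {k : ρ} {e : ℕ} (hk : HasPivotAt s (P k) j e) :
    δ k = e ∧ rowDegree s P k = e + s j := by
  obtain ⟨l, hl, hδ⟩ := h k
  obtain ⟨rfl, he⟩ := hl.hasPivotAt.eq_and_eq hk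
  refine ⟨?_, ?_⟩
  · rw [degree_eq_natDegree hl.apply_ne_zero, he] at hδ
    exact_mod_cast hδ.symm
  · rw [rowDegree, hl.shiftedDegree_eq, zdeg_eq_natDegree hl.apply_ne_zero, he,
      ← WithBot.coe_add]
    rfl

end bridge

/-! ### Popov bases and minimality of their pivot degrees -/

/-- `P` is the `s`-Popov basis of the submodule `S`, of `s`-pivot degree `δ`, in terms of integer
degree bounds. -/
structure IsPopovBasis {K : Type*} [Field K] {ι : Type*} [Fintype ι] [LinearOrder ι] (s : ι → ℤ)
    (S : Submodule K[X] (ι → K[X])) (P : Matrix ι ι K[X]) (δ : ι → ℕ) : Prop where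
  pivot : ∀ k, HasPivotAt s (P k) k (δ k)
  column : ∀ k l, l ≠ k → DegLE (P l k) (δ k - 1)
  mem_iff : ∀ x, x ∈ S ↔ ∃ w, Matrix.vecMul w P = x

section basis

variable {K : Type*} [Field K] {ι : Type*} [Fintype ι] [LinearOrder ι] {s : ι → ℤ}

/-- A Popov basis is square, so this puts every pivot on the diagonal. -/
theorem StrictMono.eq_self {f : ι → ι} (hf : StrictMono f) (k : ι) : f k = k :=
  le_antisymm hf.apply_le hf.le_apply

theorem IsPopovSolutionBasis.isPopovBasis {a : K[X]} {F : ι → K[X]} {P : Matrix ι ι K[X]}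
    (h : IsPopovSolutionBasis s a F P) :
    IsPopovBasis s (solutionModule a F) P fun k => (P k k).natDegree := by
  obtain ⟨⟨-, hspan⟩, -, piv, hmono, hpiv, -, hcol⟩ := h
  simp only [hmono.eq_self] at hpiv hcol
  refine ⟨fun k => (hpiv k).hasPivotAt, fun k l hlk => .of_degree_lt (hcol k l hlk) rfl,
    fun x => ?_⟩
  rw [← hspan, Submodule.mem_span_range_iff_exists_fun]
  refine exists_congr fun w => ?_
  rw [Matrix.vecMul_eq_sum]
  rfl

theorem IsPopovSolutionBasis.isPopovBasis_of_hasPivotDegree {a : K[X]} {F : ι → K[X]}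
    {P : Matrix ι ι K[X]} {δ : ι → ℕ} (h : IsPopovSolutionBasis s a F P)
    (hδ : HasPivotDegree s P δ) : IsPopovBasis s (solutionModule a F) P δ := by
  have hP := h.isPopovBasis
  have : δ = fun k => (P k k).natDegree :=
    funext fun k => (hδ.eq_of_hasPivotAt (hP.pivot k)).1
  rwa [this]

namespace IsPopovBasis

variable {S : Submodule K[X] (ι → K[X])} {P : Matrix ι ι K[X]} {δ : ι → ℕ} {x : ι → K[X]}

theorem row_mem (h : IsPopovBasis s S P δ) (k : ι) : P k ∈ S :=
  (h.mem_iff _).mpr ⟨Pi.single k 1, by rw [Matrix.single_one_vecMul]; rfl⟩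

theorem entry (h : IsPopovBasis s S P δ) (l k : ι) : DegLE (P l k) (δ k) := by
  by_cases hlk : l = k
  · subst hlk
    exact ((h.pivot l).2.2 l).mono (by rw [tie_self]; omega)
  · exact (h.column k l hlk).mono (by omega)

theorem exists_vecMul (h : IsPopovBasis s S P δ) (hx : x ∈ S) {l : ι} {e : ℕ}
    (hp : HasPivotAt s x l e) :
    ∃ w e', Matrix.vecMul w P = x ∧ HasPivotAt (fun k => (δ k : ℤ) + s k) w l e' ∧
      e = e' + δ l := by
  obtain ⟨w, rfl⟩ := (h.mem_iff x).mp hx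
  have hw : w ≠ 0 := by
    rintro rfl
    exact hp.1 (by simp)
  obtain ⟨a, e', ha⟩ := HasPivotAt.exists_of_ne_zero (fun k => (δ k : ℤ) + s k) hw
  obtain ⟨rfl, he⟩ := hp.eq_and_eq (HasPivotAt.vecMul h.pivot ha)
  exact ⟨w, e', rfl, ha, he⟩

/-- The pivot of the coefficient vector contributes a nonnegative degree on top of `δ l`. Since `P
l` attains equality, `δ l` is a minimum. -/
theorem le_of_hasPivotAt (h : IsPopovBasis s S P δ) (hx : x ∈ S) {l : ι} {e : ℕ}
    (hp : HasPivotAt s x l e) : δ l ≤ e := by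
  obtain ⟨w, e', -, -, he⟩ := h.exists_vecMul hx hp
  omega

theorem eq_zero_of_degLE (h : IsPopovBasis s S P δ) (hx : x ∈ S)
    (hd : ∀ k, DegLE (x k) (δ k - 1)) : x = 0 := by
  by_contra h0
  obtain ⟨l, e, hl⟩ := HasPivotAt.exists_of_ne_zero s h0
  have h1 := h.le_of_hasPivotAt hx hl
  have h2 := hd l hl.1
  rw [hl.2.1] at h2
  omega

/-- The pivot degree of a solution basis modulo `X ^ τ` sums to at most `τ`. -/
theorem sum_le_of_order {F : ι → K[X]} {τ : ℕ}
    (h : IsPopovBasis s (solutionModule (X ^ τ) F) P δ) : ∑ k, δ k ≤ τ := by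
  -- The first `τ` coefficients of `xF`, for `deg (x k) < δ k`. A kernel element is a solution with
  -- all degrees below `δ`, hence zero, and dimensions can be compared.
  let V : ((k : ι) → degreeLT K (δ k)) →ₗ[K] Fin τ → K :=
    { toFun := fun x r => ((fun k => (x k : K[X])) ⬝ᵥ F).coeff r
      map_add' := fun x y => by
        ext r
        simp [dotProduct, add_mul, Finset.sum_add_distrib]
      map_smul' := fun c x => by
        ext r
        simp [dotProduct, Finset.mul_sum] }
  have hinj : Function.Injective V := by
    rw [injective_iff_map_eq_zero]
    intro x hx
    have hmem : (fun k => (x k : K[X])) ∈ solutionModule (X ^ τ) F := by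
      change X ^ τ ∣ (fun k => (x k : K[X])) ⬝ᵥ F
      rw [X_pow_dvd_iff]
      intro r hr
      exact congrFun hx (⟨r, hr⟩ : Fin τ)
    have h0 := h.eq_zero_of_degLE hmem fun k hk => by
      have hlt := (Polynomial.mem_degreeLT (R := K)).mp (x k).2
      rw [← natDegree_lt_iff_degree_lt hk] at hlt
      omega
    funext k
    exact Subtype.ext (congrFun h0 k)
  have h1 := LinearMap.finrank_le_finrank_of_injective hinj
  have h2 (k : ι) : Module.finrank K (degreeLT K (δ k)) = δ k := by
    rw [(degreeLTEquiv K (δ k)).finrank_eq, Module.finrank_fin_fun]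
  have (k : ι) : Module.Finite K (degreeLT K (δ k)) :=
    Module.Finite.equiv (degreeLTEquiv K (δ k)).symm
  rw [Module.finrank_pi_fintype, Module.finrank_fin_fun] at h1
  simpa only [h2] using h1

end IsPopovBasis

end basis

/-! ### Exact relations and the head of the order basis -/

theorem exists_cofactor {K : Type*} [Field K] {ι : Type*} [Fintype ι] {a : K[X]} {n : ℕ} (ha : a ≠ 0) (hn : a.natDegree = n) {F : ι → K[X]}
    (hF : ∀ k, DegLE (F k) (n - 1)) {x : ι → K[X]} (hx : x ∈ solutionModule a F) {N : ℤ}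
    (hN : ∀ k, DegLE (x k) N) : ∃ y, x ⬝ᵥ F + y * a = 0 ∧ DegLE y (N - 1) := by
  obtain ⟨c, hc⟩ : a ∣ x ⬝ᵥ F := hx
  refine ⟨-c, by rw [hc]; ring, ?_⟩
  have h1 : DegLE (x ⬝ᵥ F) (N + (n - 1)) := DegLE.sum fun k _ => (hN k).mul (hF k)
  rw [hc, mul_comm] at h1
  exact ((h1.of_mul ha).mono (by omega)).neg

theorem dotProduct_appendEntry {R : Type*} [CommRing R] {m : ℕ} (x : Fin (m + 1) → R)
    (F : Fin m → R) (c : R) :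
    x ⬝ᵥ appendEntry F c = (fun k => x k.castSucc) ⬝ᵥ F + x (Fin.last m) * c := by
  simp [dotProduct, appendEntry, Fin.sum_univ_castSucc]

/-- A system `(𝔪, F)` with Popov basis `P` of pivot degree `δ`, whose indices split into the set
`Hd` and its complement so that the `s`-degrees of the rows of `P` at `Hd` are less than `μ`, the
smallest shift outside `Hd`; and the Popov order basis `B` for `(F, 𝔪)` at order `2 σ`, of pivot
degree `β`, for the shift `u` which bounds the degrees of the part of `P` at `Hd`. -/
structure IsSplitSystem {K : Type*} [Field K] {m : ℕ} (Hd : Fin m → Prop) (𝔪 : K[X])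
    (F : Fin m → K[X]) (σ : ℕ) (s : Fin m → ℤ) (P : Matrix (Fin m) (Fin m) K[X]) (δ : Fin m → ℕ)
    (μ : ℤ) (D : ℕ) (u : Fin (m + 1) → ℤ) (B : Matrix (Fin (m + 1)) (Fin (m + 1)) K[X])
    (β : Fin (m + 1) → ℕ) : Prop where
  ne_zero : 𝔪 ≠ 0
  natDegree_eq : 𝔪.natDegree = σ
  degLE : ∀ k, DegLE (F k) (σ - 1)
  basis : IsPopovBasis s (solutionModule 𝔪 F) P δ
  head_lt : ∀ k, Hd k → δ k + s k < μ
  le_tail : ∀ k, ¬ Hd k → μ ≤ s k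
  head_le : ∀ k, Hd k → δ k ≤ D
  le_sigma : D ≤ σ
  shift_head : ∀ k, Hd k → u k.castSucc = μ - δ k - 2 * σ
  shift_tail : ∀ k, ¬ Hd k → u k.castSucc = s k
  shift_last : u (Fin.last m) = μ - D - 2 * σ
  order_basis : IsPopovBasis u (solutionModule (X ^ (2 * σ)) (appendEntry F 𝔪)) B β

namespace IsSplitSystem

variable {K : Type*} [Field K] {m : ℕ} {Hd : Fin m → Prop} {𝔪 : K[X]} {F : Fin m → K[X]} {σ : ℕ}
  {s : Fin m → ℤ} {P : Matrix (Fin m) (Fin m) K[X]} {δ : Fin m → ℕ} {μ : ℤ} {D : ℕ}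
  {u : Fin (m + 1) → ℤ} {B : Matrix (Fin (m + 1)) (Fin (m + 1)) K[X]} {β : Fin (m + 1) → ℕ}

theorem exists_lift (h : IsSplitSystem Hd 𝔪 F σ s P δ μ D u B β) {p : Fin m → K[X]}
    (hp : p ∈ solutionModule 𝔪 F) {N : ℤ} (hN : ∀ k, DegLE (p k) N) :
    ∃ x : Fin (m + 1) → K[X], (∀ k, x k.castSucc = p k) ∧ DegLE (x (Fin.last m)) (N - 1) ∧
      x ⬝ᵥ appendEntry F 𝔪 = 0 := by
  obtain ⟨y, hy, hyN⟩ := exists_cofactor h.ne_zero h.natDegree_eq h.degLE hp hN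
  refine ⟨Fin.snoc (α := fun _ => K[X]) p y, fun k => by simp, by simpa using hyN, ?_⟩
  rw [dotProduct_appendEntry]
  simpa using hy

theorem mem_of_eq_zero {x : Fin (m + 1) → K[X]} (hx : x ⬝ᵥ appendEntry F 𝔪 = 0) :
    x ∈ solutionModule (X ^ (2 * σ)) (appendEntry F 𝔪) := by
  change X ^ (2 * σ) ∣ x ⬝ᵥ appendEntry F 𝔪
  rw [hx]
  exact dvd_zero _

theorem castSucc_mem_of_eq_zero {x : Fin (m + 1) → K[X]} (hx : x ⬝ᵥ appendEntry F 𝔪 = 0) :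
    (fun k => x k.castSucc) ∈ solutionModule 𝔪 F := by
  rw [dotProduct_appendEntry] at hx
  exact ⟨-x (Fin.last m), by rw [eq_neg_of_add_eq_zero_left hx]; ring⟩

theorem degLE_dotProduct (h : IsSplitSystem Hd 𝔪 F σ s P δ μ D u B β) {x : Fin (m + 1) → K[X]}
    {N : ℤ} (hN : ∀ k : Fin m, DegLE (x k.castSucc) N) (hl : DegLE (x (Fin.last m)) (N - 1)) :
    DegLE (x ⬝ᵥ appendEntry F 𝔪) (N + σ - 1) := by
  rw [dotProduct_appendEntry]
  refine DegLE.add (DegLE.sum fun k _ => ((hN k).mul (h.degLE k)).mono (by omega)) ?_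
  refine (hl.mul (DegLE.natDegree_self 𝔪)).mono ?_
  rw [h.natDegree_eq]
  omega

/-- The row `P k` vanishes on the tail. Its lift has `u`-degree `μ - 2σ`, attained only at `k`: the
other head entries have degree below the pivots of their columns, and the cofactor has degree below
`D`. -/
theorem pivotDegree_le_of_head (h : IsSplitSystem Hd 𝔪 F σ s P δ μ D u B β) {k : Fin m}
    (hk : Hd k) : β k.castSucc ≤ δ k := by
  have htail (l : Fin m) (hl : ¬ Hd l) : P k l = 0 := by
    refine ((h.basis.pivot k).2.2 l).eq_zero ?_
    have := h.head_lt k hk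
    have := h.le_tail l hl
    have := tie_nonneg k l
    omega
  obtain ⟨x, hx, hlast, h0⟩ := h.exists_lift (h.basis.row_mem k) (N := D) fun l => by
    by_cases hl : Hd l
    · exact (h.basis.entry k l).mono (by exact_mod_cast h.head_le l hl)
    · rw [htail l hl]
      exact DegLE.zero _
  refine h.order_basis.le_of_hasPivotAt (mem_of_eq_zero h0) ⟨?_, ?_, fun c => ?_⟩
  · rw [hx]
    exact (h.basis.pivot k).1
  · rw [hx]
    exact (h.basis.pivot k).2.1
  · induction c using Fin.lastCases with
    | last =>
      refine hlast.mono ?_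
      rw [h.shift_head k hk, h.shift_last, tie_castSucc_last]
      omega
    | cast l =>
      rw [hx, tie_castSucc]
      by_cases hl : Hd l
      · rw [h.shift_head k hk, h.shift_head l hl]
        by_cases hkl : k = l
        · subst hkl
          rw [tie_self]
          exact (h.basis.entry k k).mono (by omega)
        · refine (h.basis.column l k hkl).mono ?_
          have := tie_le_one k l
          omega
      · rw [htail l hl]
        exact DegLE.zero _

/-- The previous bound limits the `u`-degree of the row to `μ - 2σ`, so its entries have degree at
most `D ≤ σ` and its residual has degree below `2σ`, yet is divisible by `X ^ (2 * σ)`. -/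
theorem dotProduct_eq_zero_of_head (h : IsSplitSystem Hd 𝔪 F σ s P δ μ D u B β) {k : Fin m}
    (hk : Hd k) : B k.castSucc ⬝ᵥ appendEntry F 𝔪 = 0 := by
  have hle := h.pivotDegree_le_of_head hk
  have hp := h.order_basis.pivot k.castSucc
  have hD := h.le_sigma
  refine DegLE.dvd_eq_zero (n := 2 * σ) ?_ (h.order_basis.row_mem k.castSucc)
  refine (h.degLE_dotProduct (N := D) (fun l => ?_) ?_).mono (by push_cast; omega)
  · refine (hp.2.2 l.castSucc).mono ?_
    have := tie_nonneg k.castSucc l.castSucc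
    rw [h.shift_head k hk]
    by_cases hl : Hd l
    · have := h.head_le l hl
      rw [h.shift_head l hl]
      omega
    · have := h.le_tail l hl
      rw [h.shift_tail l hl]
      omega
  · refine (hp.2.2 (Fin.last m)).mono ?_
    rw [h.shift_head k hk, h.shift_last, tie_castSucc_last]
    omega

/-- A smaller pivot degree would make the row an exact relation whose entries all have degree below
`δ`, hence zero. -/
theorem pivotDegree_eq_of_head (h : IsSplitSystem Hd 𝔪 F σ s P δ μ D u B β) {k : Fin m}
    (hk : Hd k) : β k.castSucc = δ k := by
  refine le_antisymm (h.pivotDegree_le_of_head hk) (not_lt.mp fun hlt => ?_)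
  have hp := h.order_basis.pivot k.castSucc
  have hmem := castSucc_mem_of_eq_zero (h.dotProduct_eq_zero_of_head hk)
  refine hp.1 (congrFun (h.basis.eq_zero_of_degLE hmem fun l => ?_) k)
  refine (hp.2.2 l.castSucc).mono ?_
  have := tie_nonneg k.castSucc l.castSucc
  rw [h.shift_head k hk]
  by_cases hl : Hd l
  · rw [h.shift_head l hl]
    omega
  · have := h.le_tail l hl
    rw [h.shift_tail l hl]
    omega

/-- The shift at the last index is at most all the others, so no entry of this row exceeds the pivot
in degree; as `deg F < deg 𝔪`, the term in `𝔪` dominates. -/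
theorem dotProduct_last (h : IsSplitSystem Hd 𝔪 F σ s P δ μ D u B β) :
    B (Fin.last m) ⬝ᵥ appendEntry F 𝔪 ≠ 0 ∧
      (B (Fin.last m) ⬝ᵥ appendEntry F 𝔪).natDegree = β (Fin.last m) + σ := by
  have hp := h.order_basis.pivot (Fin.last m)
  have hne := mul_ne_zero hp.1 h.ne_zero
  have hdeg : (B (Fin.last m) (Fin.last m) * 𝔪).natDegree = β (Fin.last m) + σ := by
    rw [natDegree_mul hp.1 h.ne_zero, hp.2.1, h.natDegree_eq]
  have hD := h.le_sigma
  rw [dotProduct_appendEntry, ← hdeg]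
  refine DegLE.natDegree_add_right (DegLE.sum fun k _ => ?_) hne
  refine ((hp.2.2 k.castSucc).mul (h.degLE k)).mono ?_
  have := tie_nonneg (Fin.last m) k.castSucc
  rw [hdeg, h.shift_last]
  push_cast
  by_cases hk : Hd k
  · have := h.head_le k hk
    rw [h.shift_head k hk]
    omega
  · have := h.le_tail k hk
    rw [h.shift_tail k hk]
    omega

/-! ### The residual problem -/

section residual

variable {𝔫 : K[X]} {G : {k // ¬ Hd k} → K[X]}

theorem residual_last (h : IsSplitSystem Hd 𝔪 F σ s P δ μ D u B β)
    (h𝔫 : X ^ (2 * σ) * 𝔫 = B (Fin.last m) ⬝ᵥ appendEntry F 𝔪) :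
    𝔫 ≠ 0 ∧ β (Fin.last m) = 𝔫.natDegree + σ := by
  obtain ⟨h1, h2⟩ := h.dotProduct_last
  rw [← h𝔫] at h1 h2
  have hne := right_ne_zero_of_mul h1
  rw [natDegree_mul (left_ne_zero_of_mul h1) hne, natDegree_X_pow] at h2
  exact ⟨hne, by omega⟩

theorem sum_add_last_le (h : IsSplitSystem Hd 𝔪 F σ s P δ μ D u B β) :
    ∑ k : Fin m, β k.castSucc + β (Fin.last m) ≤ 2 * σ := by
  have := h.order_basis.sum_le_of_order
  rwa [Fin.sum_univ_castSucc] at this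

/-- The last pivot degree is at least `σ` and all of them sum to at most `2σ`, so it bounds each of
the others; the last column is strictly below it off the diagonal. -/
theorem degLE_residual (h : IsSplitSystem Hd 𝔪 F σ s P δ μ D u B β)
    (h𝔫 : X ^ (2 * σ) * 𝔫 = B (Fin.last m) ⬝ᵥ appendEntry F 𝔪)
    (hG : ∀ k, X ^ (2 * σ) * G k = B (k : Fin m).castSucc ⬝ᵥ appendEntry F 𝔪)
    (k : {k // ¬ Hd k}) : DegLE (G k) (𝔫.natDegree - 1) := by
  have h1 := h.sum_add_last_le
  have h2 := (h.residual_last h𝔫).2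
  have h3 : DegLE (G k * X ^ (2 * σ)) (β (Fin.last m) + σ - 1) := by
    rw [mul_comm, hG]
    refine h.degLE_dotProduct (fun l => (h.order_basis.entry _ _).mono ?_)
      (h.order_basis.column _ _ (Fin.castSucc_lt_last _).ne)
    have := Finset.single_le_sum (f := fun k : Fin m => β k.castSucc) (fun _ _ => Nat.zero_le _)
      (Finset.mem_univ l)
    omega
  refine (h3.of_mul (pow_ne_zero _ X_ne_zero)).mono ?_
  rw [natDegree_X_pow]
  omega

theorem hasPivotAt_tail (h : IsSplitSystem Hd 𝔪 F σ s P δ μ D u B β) (k : {k // ¬ Hd k}) :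
    HasPivotAt (fun l : {k // ¬ Hd k} => s l)
      (fun l : {k // ¬ Hd k} => B (k : Fin m).castSucc (l : Fin m).castSucc) k
      (β (k : Fin m).castSucc) := by
  have hp := h.order_basis.pivot (k : Fin m).castSucc
  refine ⟨hp.1, hp.2.1, fun l => (hp.2.2 (l : Fin m).castSucc).mono ?_⟩
  rw [h.shift_tail k k.2, h.shift_tail l l.2, tie_castSucc, tie_coe]

variable [DecidablePred Hd]

/-- A solution of the residual problem with pivot `l` yields a solution of the full one. -/
theorem le_of_residual (h : IsSplitSystem Hd 𝔪 F σ s P δ μ D u B β)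
    (h𝔫 : X ^ (2 * σ) * 𝔫 = B (Fin.last m) ⬝ᵥ appendEntry F 𝔪)
    (hG : ∀ k, X ^ (2 * σ) * G k = B (k : Fin m).castSucc ⬝ᵥ appendEntry F 𝔪)
    {w : {k // ¬ Hd k} → K[X]} (hw : w ∈ solutionModule 𝔫 G) {l : {k // ¬ Hd k}} {e : ℕ}
    (hl : HasPivotAt (fun k : {k // ¬ Hd k} => (β (k : Fin m).castSucc : ℤ) + s k) w l e) :
    δ l ≤ e + β (l : Fin m).castSucc := by
  have hμl := h.le_tail l l.2
  have hγ : β (Fin.last m) ≤ 2 * σ := le_trans (Nat.le_add_left _ _) h.sum_add_last_le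
  -- As every tail shift is at least `μ`, this `N` bounds the degrees of all entries of `w`.
  obtain ⟨N, hN⟩ : ∃ N : ℤ, N + μ = e + (β (l : Fin m).castSucc + s l) := ⟨_, sub_add_cancel _ μ⟩
  have hwN (k : {k // ¬ Hd k}) : DegLE (w k) N := by
    refine (hl.2.2 k).mono ?_
    have := h.le_tail k k.2
    have := tie_nonneg l k
    dsimp only
    omega
  obtain ⟨y, hy0, hyN⟩ := exists_cofactor (h.residual_last h𝔫).1 rfl (h.degLE_residual h𝔫 hG) hw hwN
  let x : Fin (m + 1) → K[X] :=
    fun c => ∑ k, w k * B (k : Fin m).castSucc c + y * B (Fin.last m) c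
  have hx0 : x ⬝ᵥ appendEntry F 𝔪 = 0 := by
    have hx : x = ∑ k, w k • B (k : Fin m).castSucc + y • B (Fin.last m) := by
      ext1 c
      simp [x]
    rw [hx, add_dotProduct, sum_dotProduct, smul_dotProduct, ← h𝔫]
    simp only [smul_dotProduct, ← hG, smul_eq_mul]
    rw [← mul_zero (X ^ (2 * σ)), ← hy0, dotProduct, mul_add, Finset.mul_sum]
    congr 1
    · exact Finset.sum_congr rfl fun k _ => by ring
    · ring
  -- The multiple of the last row is negligible on the tail: its pivot degree is at most `2σ`, which
  -- the `-2σ` in its shift offsets.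
  have htail := (HasPivotAt.vecMul (P := Matrix.of fun k l : {k // ¬ Hd k} =>
    B (k : Fin m).castSucc (l : Fin m).castSucc) h.hasPivotAt_tail hl).add
    (y := fun c : {k // ¬ Hd k} => y * B (Fin.last m) (c : Fin m).castSucc) fun c => by
      refine (hyN.mul ((h.order_basis.pivot (Fin.last m)).2.2 (c : Fin m).castSucc)).mono ?_
      have := tie_nonneg (Fin.last m) (c : Fin m).castSucc
      rw [h.shift_last, h.shift_tail c c.2]
      push_cast
      omega
  refine h.basis.le_of_hasPivotAt (castSucc_mem_of_eq_zero hx0) (e := e + β (l : Fin m).castSucc)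
    ⟨htail.1, htail.2.1, fun c => ?_⟩
  by_cases hc : Hd c
  · have h1 := h.head_lt c hc
    have h2 := tie_le_one (l : Fin m) c
    -- On the head, column reducedness of `B` bounds the entries by `N + δ c - 1`, and `δ c + s c <
    -- μ` leaves the required margin.
    refine DegLE.add (DegLE.sum fun k _ => ?_) ?_
    · have hcol := h.order_basis.column c.castSucc (k : Fin m).castSucc fun hkc =>
        k.2 (by rwa [Fin.castSucc_injective _ hkc])
      rw [h.pivotDegree_eq_of_head hc] at hcol
      exact ((hwN k).mul hcol).mono (by push_cast; omega)
    · have hcol := h.order_basis.column c.castSucc _ (Fin.castSucc_lt_last c).ne'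
      rw [h.pivotDegree_eq_of_head hc] at hcol
      exact (hyN.mul hcol).mono (by push_cast; omega)
  · exact htail.2.2 ⟨c, hc⟩

/-- A row of the full basis at an index `l` outside `Hd` yields a solution of the residual problem
with pivot `l`. -/
theorem exists_residual (h : IsSplitSystem Hd 𝔪 F σ s P δ μ D u B β)
    (h𝔫 : X ^ (2 * σ) * 𝔫 = B (Fin.last m) ⬝ᵥ appendEntry F 𝔪)
    (hG : ∀ k, X ^ (2 * σ) * G k = B (k : Fin m).castSucc ⬝ᵥ appendEntry F 𝔪)
    (l : {k // ¬ Hd k}) : ∃ w ∈ solutionModule 𝔫 G, ∃ e,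
      HasPivotAt (fun k : {k // ¬ Hd k} => (β (k : Fin m).castSucc : ℤ) + s k) w l e ∧
        δ l = e + β (l : Fin m).castSucc := by
  have hμl := h.le_tail l l.2
  have hp := h.basis.pivot l
  have hcol (k : Fin m) (hk : Hd k) : DegLE (P l k) (δ k - 1) :=
    h.basis.column k l fun hlk => l.2 (by rwa [hlk])
  -- The summand `D` covers the head entries; it is cancelled by the `-D` in the last shift when the
  -- cofactor is compared with the pivot.
  obtain ⟨x, hx, hlast, hx0⟩ := h.exists_lift (h.basis.row_mem l) (N := δ l + s l - μ + D)
    fun k => by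
      by_cases hk : Hd k
      · have := h.head_le k hk
        exact (hcol k hk).mono (by omega)
      · have := h.le_tail k hk
        have := tie_nonneg (l : Fin m) k
        exact (hp.2.2 k).mono (by omega)
  have hpx : HasPivotAt u x (l : Fin m).castSucc (δ l) := by
    refine ⟨by rw [hx]; exact hp.1, by rw [hx]; exact hp.2.1, fun c => ?_⟩
    rw [h.shift_tail l l.2]
    induction c using Fin.lastCases with
    | last =>
      refine hlast.mono ?_
      rw [h.shift_last, tie_castSucc_last]
      omega
    | cast k =>
      rw [hx, tie_castSucc]
      by_cases hk : Hd k
      · refine (hcol k hk).mono ?_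
        have := tie_le_one (l : Fin m) k
        rw [h.shift_head k hk]
        omega
      · rw [h.shift_tail k hk]
        exact hp.2.2 k
  obtain ⟨z, e, rfl, hz, he⟩ := h.order_basis.exists_vecMul (mem_of_eq_zero hx0) hpx
  refine ⟨fun k => z (k : Fin m).castSucc, ⟨-z (Fin.last m), ?_⟩, e,
    ⟨hz.1, hz.2.1, fun k => (hz.2.2 (k : Fin m).castSucc).mono ?_⟩, he⟩
  -- Head rows of `B` have zero residual and drop out, leaving a relation between `G` and `𝔫` after
  -- division by `X ^ (2 * σ)`.
  · rw [Matrix.vecMul_eq_sum, sum_dotProduct, Fin.sum_univ_castSucc,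
      ← Fintype.sum_subtype_add_sum_subtype Hd,
      Finset.sum_eq_zero (s := (Finset.univ : Finset {k // Hd k})) fun k _ => by
        rw [smul_dotProduct]
        exact (congrArg _ (h.dotProduct_eq_zero_of_head k.2)).trans (smul_zero _),
      zero_add] at hx0
    simp only [smul_dotProduct] at hx0
    have hfac : X ^ (2 * σ) * ((fun k : {k // ¬ Hd k} => z (k : Fin m).castSucc) ⬝ᵥ G
        + z (Fin.last m) * 𝔫) = 0 := by
      rw [← hx0, mul_add, dotProduct, Finset.mul_sum, ← h𝔫]
      congr 1
      · exact Finset.sum_congr rfl fun k _ => by rw [← hG, smul_eq_mul]; ring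
      · rw [smul_eq_mul]
        ring
    have h0 := (mul_eq_zero.mp hfac).resolve_left (pow_ne_zero _ X_ne_zero)
    rw [eq_neg_of_add_eq_zero_left h0]
    ring
  · dsimp only
    rw [h.shift_tail l l.2, h.shift_tail k k.2, tie_castSucc, tie_coe]

end residual

end IsSplitSystem

/-! ### Restriction to a subset of the indices -/

section restriction

theorem dotProduct_subtype {R : Type*} [CommRing R] {ι : Type*} [Fintype ι] {q : ι → Prop}
    [DecidablePred q] {x F : ι → R} (hx : ∀ k, ¬ q k → x k = 0) :
    (fun k : Subtype q => x k) ⬝ᵥ (fun k : Subtype q => F k) = x ⬝ᵥ F := by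
  rw [dotProduct, dotProduct, ← Fintype.sum_subtype_add_sum_subtype q (fun k => x k * F k),
    Finset.sum_eq_zero (s := (Finset.univ : Finset {k // ¬ q k})) fun k _ => by
      rw [hx k k.2, zero_mul], add_zero]

variable {K : Type*} [Field K] {ι : Type*} [Fintype ι] [LinearOrder ι] {q : ι → Prop}
  [DecidablePred q] {s : ι → ℤ} {a : K[X]} {F : ι → K[X]}

variable {P : Matrix ι ι K[X]} {P' : Matrix (Subtype q) (Subtype q) K[X]} {δ : ι → ℕ}
  {δ' : Subtype q → ℕ}

/-- Padding a solution of the subproblem with zeros solves the full problem with the same pivot. -/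
theorem IsPopovBasis.le_of_subtype (h : IsPopovBasis s (solutionModule a F) P δ)
    (h' : IsPopovBasis (fun k : Subtype q => s k)
      (solutionModule a fun k : Subtype q => F k) P' δ') (k : Subtype q) : δ k ≤ δ' k := by
  let x : ι → K[X] := fun l => if hl : q l then P' k ⟨l, hl⟩ else 0
  have hx (l : Subtype q) : x l = P' k l := dif_pos l.2
  have hx0 (l : ι) (hl : ¬ q l) : x l = 0 := dif_neg hl
  have hp := h'.pivot k
  refine h.le_of_hasPivotAt (x := x) ?_
    ⟨by rw [hx]; exact hp.1, by rw [hx]; exact hp.2.1, fun l => ?_⟩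
  · change a ∣ x ⬝ᵥ F
    rw [← dotProduct_subtype hx0]
    simp only [hx]
    exact h'.row_mem k
  · by_cases hl : q l
    · rw [hx ⟨l, hl⟩]
      exact hp.2.2 ⟨l, hl⟩
    · rw [hx0 l hl]
      exact DegLE.zero _

/-- The hypothesis `hk` makes row `k` vanish outside the subset, so it restricts to a solution of
the subproblem. -/
theorem IsPopovBasis.eq_of_subtype (h : IsPopovBasis s (solutionModule a F) P δ)
    (h' : IsPopovBasis (fun k : Subtype q => s k)
      (solutionModule a fun k : Subtype q => F k) P' δ') (k : Subtype q)
    (hk : ∀ l, ¬ q l → δ k + s k < s l) : δ k = δ' k := by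
  refine le_antisymm (h.le_of_subtype h' k) ?_
  have hp := h.pivot k
  refine h'.le_of_hasPivotAt (x := fun l : Subtype q => P k l) ?_ ⟨hp.1, hp.2.1, fun l => hp.2.2 l⟩
  change a ∣ (fun l : Subtype q => P k l) ⬝ᵥ (fun l : Subtype q => F l)
  rw [dotProduct_subtype fun l hl => ((hp.2.2 l).eq_zero ?_)]
  · exact h.row_mem k
  · have := hk l hl
    have := tie_nonneg (k : ι) l
    omega

end restriction

/-! ### The splitting threshold and the final assembly -/

/-- The first `i` indices of a splitting are those of `Head π i`. -/
theorem IsSplittingIndex.exists_threshold {m i j : ℕ} {s : Fin m → ℤ} {π : Equiv.Perm (Fin m)}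
    (hπ : Monotone (s ∘ π)) (hj : j ≤ m) {δ : Head π j → ℕ}
    (h : IsSplittingIndex j δ (fun k : Head π j => s k) i) :
    1 ≤ i ∧ i < j ∧ ∃ θ : ℤ, (∀ k : Head π j, ((π.symm k : Fin m) : ℕ) < i → δ k + s k < θ) ∧
      ∀ k : Fin m, ¬ ((π.symm k : Fin m) : ℕ) < i → θ ≤ s k := by
  obtain ⟨h1, hij, ν, hν, hlt⟩ := h
  have hmono {k l : Fin m} (hkl : π.symm k ≤ π.symm l) : s k ≤ s l := by
    simpa using hπ hkl
  have hge (b : Fin j) (hb : ¬ (b : ℕ) < i) : s (ν ⟨i, hij⟩) ≤ s (ν b) :=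
    hν (show (⟨i, hij⟩ : Fin j) ≤ b from not_lt.mp hb)
  refine ⟨h1, hij, s (ν ⟨i, hij⟩), fun k hk => ?_, fun k hk => ?_⟩
  · obtain ⟨b, rfl⟩ := ν.surjective k
    by_cases hb : (b : ℕ) < i
    · have := hlt b hb
      dsimp only at this
      omega
    · exfalso
      -- The first `i` indices along `ν` have shifts strictly below that of `ν b`, so `π` places all
      -- of them before it, although its position is less than `i`.
      have hpos (c : Fin i) :
          ((π.symm (ν (c.castLE hij.le)) : Fin m) : ℕ) < (π.symm (ν b) : Fin m) := by
        by_contra hc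
        have h2 := hmono (not_lt.mp hc)
        have h3 := hlt (c.castLE hij.le) c.2
        have h4 := hge b hb
        dsimp only at h3
        omega
      have hcard := Fintype.card_le_of_injective
        (fun c : Fin i => (⟨_, hpos c⟩ : Fin (π.symm (ν b) : Fin m))) fun c c' hcc => by
          have h2 := Fin.ext (Fin.mk.inj_iff.mp hcc)
          exact Fin.castLE_injective _ (ν.injective (Subtype.ext (π.symm.injective h2)))
      simp only [Fintype.card_fin] at hcard
      omega
  · by_contra hlt'
    -- If `s k < θ`, the first `i + 1` indices along `π` have shifts below `θ`, so all lie among the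
    -- first `i` along `ν`.
    have hpos (c : Fin (i + 1)) : ∃ b : Fin i,
        ((ν (b.castLE hij.le) : Head π j) : Fin m) = π (c.castLE (hij.trans_le hj)) := by
      obtain ⟨b, hb⟩ := ν.surjective ⟨π (c.castLE (hij.trans_le hj)), by
        rw [Equiv.symm_apply_apply]
        exact lt_of_lt_of_le c.2 hij⟩
      have hb' := congrArg Subtype.val hb
      have hbi : (b : ℕ) < i := by
        by_contra hbi
        have h2 := hge b hbi
        have h3 : s (ν b) ≤ s k := hmono (by
          rw [hb', Equiv.symm_apply_apply, Fin.le_def, Fin.val_castLE]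
          have := c.2
          omega)
        omega
      exact ⟨⟨b, hbi⟩, hb'⟩
    choose f hf using hpos
    have hcard := Fintype.card_le_of_injective f fun c c' hcc => by
      have h2 := hf c
      rw [hcc, hf c'] at h2
      exact (Fin.castLE_injective _ (π.injective h2)).symm
    simp only [Fintype.card_fin] at hcard
    omega

/-- The multiple by `a` of a unit vector is always a solution. -/
theorem IsPopovBasis.le_natDegree {K : Type*} [Field K] {ι : Type*} [Fintype ι] [LinearOrder ι]
    {s : ι → ℤ} {a : K[X]} {F : ι → K[X]} {P : Matrix ι ι K[X]} {δ : ι → ℕ}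
    (h : IsPopovBasis s (solutionModule a F) P δ) (ha : a ≠ 0) (k : ι) : δ k ≤ a.natDegree := by
  refine h.le_of_hasPivotAt (x := Pi.single k a) ?_
    ⟨by simpa using ha, by simp, fun l => ?_⟩
  · change a ∣ Pi.single k a ⬝ᵥ F
    rw [single_dotProduct]
    exact dvd_mul_right _ _
  · by_cases hl : l = k
    · subst hl
      rw [Pi.single_eq_same, tie_self]
      exact (DegLE.natDegree_self a).mono (by omega)
    · rw [Pi.single_eq_of_ne hl]
      exact DegLE.zero _

theorem iInf_attained {ι : Type*} [Finite ι] [Nonempty ι] (f : ι → ℤ) :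
    (∀ k, ⨅ l, f l ≤ f k) ∧ ∃ k, f k = ⨅ l, f l :=
  ⟨fun k => ciInf_le (Set.finite_range f).bddBelow k, exists_eq_ciInf_of_finite⟩

end

theorem lemma2p9 {K : Type*} [Field K] {m : ℕ}
    -- the problem `(𝔪, F)` and the shift `s`, with its minimal degree `δ`
    (𝔪 : K[X]) (h𝔪 : 𝔪 ≠ 0) (F : Fin m → K[X]) (hF : ∀ k, (F k).degree < 𝔪.degree)
    (σ : ℕ) (hσ : σ = 𝔪.natDegree)
    (s : Fin m → ℤ) (π : Equiv.Perm (Fin m)) (hπ : Monotone (s ∘ π))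
    (δ : Fin m → ℕ) (hδ : IsMinimalDegree s 𝔪 F δ)
    -- the splitting index `i` for the subproblem on the first `j` indices
    (i j : ℕ) (hj : j ≤ m)
    (δ₀ : Head π j → ℕ)
    (hδ₀ : IsMinimalDegree (fun k : Head π j => s k) 𝔪 (fun k : Head π j => F k) δ₀)
    (hi : IsSplittingIndex j δ₀ (fun k : Head π j => s k) i)
    -- the minimal degree `δ₁` of the subproblem on the first `i` indices
    (δ₁ : Head π i → ℕ)
    (hδ₁ : IsMinimalDegree (fun k : Head π i => s k) 𝔪 (fun k : Head π i => F k) δ₁)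
    -- the shifts `s₂`, `d` and the order basis `B` with blocks `A`, `col`, `p`, `q`
    (s₂ : Tail π i → ℤ) (hs₂ : s₂ = fun k : Tail π i => s k)
    (d : Head π i → ℤ) (hd : d = fun k => -(δ₁ k : ℤ) + (⨅ l, s₂ l) - 2 * (σ : ℤ))
    (B : Matrix (Fin (m + 1)) (Fin (m + 1)) K[X])
    (hB : IsPopovOrderBasis (appendEntry (glue π i d s₂) (⨅ l, d l)) (appendEntry F 𝔪) (2 * σ) B)
    (A : Matrix (Fin m) (Fin m) K[X]) (hA : A = B.submatrix Fin.castSucc Fin.castSucc)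
    (col : Fin m → K[X]) (hcol : col = fun k => B k.castSucc (Fin.last m))
    (p : Fin m → K[X]) (hp : p = fun l => B (Fin.last m) l.castSucc)
    (q : K[X]) (hq : q = B (Fin.last m) (Fin.last m))
    (P₂ : Matrix (Tail π i) (Tail π i) K[X]) (hP₂ : P₂ = A.submatrix (fun k : Tail π i => (k : Fin m)) (fun k : Tail π i => (k : Fin m)))
    (δ₂ : Tail π i → ℕ) (hδ₂ : HasPivotDegree s₂ P₂ δ₂)
    -- the residual `(𝔫, G)`
    (𝔫 : K[X]) (h𝔫 : 𝔫 = (p ⬝ᵥ F + q * 𝔪) / X ^ (2 * σ))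
    (G : Tail π i → K[X]) (hG : G = fun k : Tail π i => (A k ⬝ᵥ F + col k * 𝔪) / X ^ (2 * σ)) :
    -- the divisions by `X ^ (2 * σ)` are exact
    X ^ (2 * σ) ∣ p ⬝ᵥ F + q * 𝔪 ∧
    (∀ k : Tail π i, X ^ (2 * σ) ∣ A k ⬝ᵥ F + col k * 𝔪) ∧
    (∀ k, (G k).degree < 𝔫.degree) ∧
    (𝔫.natDegree : ℤ) ≤ (σ : ℤ) - ∑ k, (δ₁ k : ℤ) - ∑ k, (δ₂ k : ℤ) ∧
    ∀ (P₃ : Matrix (Tail π i) (Tail π i) K[X]) (δ₃ : Tail π i → ℕ),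
      IsPopovSolutionBasis (rowDegree s₂ P₂) 𝔫 G P₃ →
      HasPivotDegree (rowDegree s₂ P₂) P₃ δ₃ →
      (∀ k : Head π i, δ k = δ₁ k) ∧ (∀ k : Tail π i, δ k = δ₂ k + δ₃ k) := by
  have hσ' := hσ.symm
  obtain ⟨P, hP, hPδ⟩ := hδ
  obtain ⟨P₀, hP₀, hPδ₀⟩ := hδ₀
  obtain ⟨P₁, hP₁, hPδ₁⟩ := hδ₁
  have hb := hP.isPopovBasis_of_hasPivotDegree hPδ
  have hb₀ := hP₀.isPopovBasis_of_hasPivotDegree hPδ₀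
  have hb₁ := hP₁.isPopovBasis_of_hasPivotDegree hPδ₁
  have hBb := IsPopovSolutionBasis.isPopovBasis hB
  obtain ⟨h1i, hij, θ, hθlt, hθle⟩ := hi.exists_threshold hπ hj
  -- The splitting passes from the subproblem to the full problem, because enlarging the index set
  -- can only lower minimal degrees.
  have hlt (k : Fin m) (hk : ((π.symm k : Fin m) : ℕ) < i) : δ k + s k < θ := by
    have h1 := hθlt ⟨k, hk.trans hij⟩ hk
    have h2 := hb.le_of_subtype hb₀ ⟨k, hk.trans hij⟩
    dsimp only at h1 h2
    omega
  have heq (k : Head π i) : δ k = δ₁ k := hb.eq_of_subtype hb₁ k fun l hl =>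
    (hlt k k.2).trans_le (hθle l hl)
  have hTail : Nonempty (Tail π i) :=
    ⟨⟨π ⟨i, by omega⟩, by rw [Equiv.symm_apply_apply]; exact lt_irrefl i⟩⟩
  have hHead : Nonempty (Head π i) :=
    ⟨⟨π ⟨0, by omega⟩, by rw [Equiv.symm_apply_apply]; exact h1i⟩⟩
  obtain ⟨hμle, l₀, hl₀⟩ := iInf_attained s₂
  obtain ⟨hdle, k₀, hk₀⟩ := iInf_attained d
  -- The index `k₀` minimises `d`, so `δ₁ k₀` is the largest entry of `δ₁`; it plays the role of
  -- `D`.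
  have hsys : IsSplitSystem (fun k : Fin m => ((π.symm k : Fin m) : ℕ) < i) 𝔪 F σ s P δ
      (⨅ l, s₂ l) (δ₁ k₀) (appendEntry (glue π i d s₂) (⨅ l, d l)) B
      (fun k => (B k k).natDegree) := by
    refine ⟨h𝔪, hσ', fun k => .of_degree_lt (hF k) hσ', hb, fun k hk => ?_, fun k hk => ?_,
      fun k hk => ?_, ?_, fun k hk => ?_, fun k hk => ?_, ?_, hBb⟩
    · rw [← hl₀, hs₂]
      exact (hlt k hk).trans_le (hθle _ l₀.2)
    · have := hμle ⟨k, hk⟩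
      rw [hs₂] at this ⊢
      exact this
    · have h1 := hdle ⟨k, hk⟩
      have h2 := heq ⟨k, hk⟩
      rw [← hk₀, hd] at h1
      dsimp only at h1 h2
      omega
    · rw [hσ]
      exact hb₁.le_natDegree h𝔪 k₀
    · have h2 := heq ⟨k, hk⟩
      dsimp only at h2
      rw [appendEntry, Fin.snoc_castSucc, glue, dif_pos hk, hd, h2]
      dsimp only
      omega
    · rw [appendEntry, Fin.snoc_castSucc, glue, dif_neg hk, hs₂]
    · rw [appendEntry, Fin.snoc_last, ← hk₀, hd]
      dsimp only
      omega
  have hres : p ⬝ᵥ F + q * 𝔪 = B (Fin.last m) ⬝ᵥ appendEntry F 𝔪 := by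
    rw [dotProduct_appendEntry, hp, hq]
  have hres' (k : Fin m) : A k ⬝ᵥ F + col k * 𝔪 = B k.castSucc ⬝ᵥ appendEntry F 𝔪 := by
    rw [dotProduct_appendEntry, hA, hcol]
    rfl
  have hdvd : X ^ (2 * σ) ∣ p ⬝ᵥ F + q * 𝔪 := by
    rw [hres]
    exact hBb.row_mem _
  have hdvd' (k : Tail π i) : X ^ (2 * σ) ∣ A k ⬝ᵥ F + col k * 𝔪 := by
    rw [hres']
    exact hBb.row_mem _
  have hX : (X : K[X]) ^ (2 * σ) ≠ 0 := pow_ne_zero _ X_ne_zero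
  have h𝔫' : X ^ (2 * σ) * 𝔫 = B (Fin.last m) ⬝ᵥ appendEntry F 𝔪 := by
    rw [h𝔫, EuclideanDomain.mul_div_cancel' hX hdvd, hres]
  have hG' (k : Tail π i) : X ^ (2 * σ) * G k = B (k : Fin m).castSucc ⬝ᵥ appendEntry F 𝔪 := by
    rw [hG]
    dsimp only
    rw [EuclideanDomain.mul_div_cancel' hX (hdvd' k), hres']
  obtain ⟨h𝔫0, hγ⟩ := hsys.residual_last h𝔫'
  have hP₂δ (k : Tail π i) := hδ₂.eq_of_hasPivotAt (k := k) (j := k)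
    (e := (B (k : Fin m).castSucc (k : Fin m).castSucc).natDegree) (by
      rw [hP₂, hA, hs₂]
      exact hsys.hasPivotAt_tail k)
  have hrow : rowDegree s₂ P₂ = fun k : Tail π i =>
      ((B (k : Fin m).castSucc (k : Fin m).castSucc).natDegree : ℤ) + s k := by
    funext k
    rw [(hP₂δ k).2, hs₂]
  refine ⟨hdvd, hdvd', fun k => (hsys.degLE_residual h𝔫' hG' k).degree_lt h𝔫0, ?_,
    fun P₃ δ₃ hP₃ hδ₃ => ⟨heq, fun k => ?_⟩⟩
  · have hsum := hsys.sum_add_last_le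
    rw [← Fintype.sum_subtype_add_sum_subtype (fun k : Fin m => ((π.symm k : Fin m) : ℕ) < i),
      Finset.sum_congr rfl fun k _ => (hsys.pivotDegree_eq_of_head k.2).trans (heq k),
      Finset.sum_congr rfl fun k _ => (hP₂δ k).1.symm] at hsum
    have h2 : ∑ k, (δ₁ k : ℤ) + ∑ k, (δ₂ k : ℤ) + (B (Fin.last m) (Fin.last m)).natDegree
        ≤ 2 * σ := by
      exact_mod_cast hsum
    omega
  · rw [hrow] at hP₃ hδ₃
    have hb₃ := hP₃.isPopovBasis_of_hasPivotDegree hδ₃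
    -- Row `k` of `P₃` gives `δ ≤ δ₂ + δ₃`; minimality of `δ₃` against the solution `w` gives the
    -- converse.
    have hle := hsys.le_of_residual h𝔫' hG' (hb₃.row_mem k) (hb₃.pivot k)
    obtain ⟨w, hw, e, hwe, he⟩ := hsys.exists_residual h𝔫' hG' k
    have hge := hb₃.le_of_hasPivotAt hw hwe
    have := (hP₂δ k).1
    omega
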